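/- All graphs are finite and simple. For a graph $G$ with $n$ vertices and $e$ edges put $\mathrm{free}(G)=2n-e-3$. A subgraph of $G$ (not necessarily induced) is called proper if it is different from $G$ and has at least three vertices. $G$ is a Laman (maximally independent) graph if $\mathrm{free}(G)=0$ and $\mathrm{free}(S)\ge 0$ for every proper subgraph $S$ of $G$; a Laman graph is basic if none of its proper subgraphs is itself a Laman graph. A graph is $3$-connected if it has more than $3$ vertices and no set $U$ of two vertices separates it, that is, there are no $U$ with $|U|=2$ and two vertices $a,b\notin U$ such that every path from $a$ to $b$ meets $U$. A graph is planar if it can be drawn in the Euclidean plane, with distinct points for vertices and simple continuous arcs for edges, so that arcs meet vertices and each other only at common ends. Corollary. Every basic Laman graph $G$ with more than $3$ vertices is $3$-connected and non-planar. -/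

import Mathlib

namespace SimpleGraph

variable {V : Type*}

/-- The freedom number `2n - e - 3` of a graph with `n` vertices and `e` edges, as an integer. -/
noncomputable def freedomNumber (G : SimpleGraph V) : ℤ :=
  2 * (Nat.card V : ℤ) - (Nat.card G.edgeSet : ℤ) - 3

/-- A subgraph of `G` (not necessarily vertex induced) is proper if it is not equal to `G` and
has at least three vertices. -/
def Subgraph.IsProper {G : SimpleGraph V} (S : G.Subgraph) : Prop :=
  S ≠ ⊤ ∧ 3 ≤ Nat.card S.verts

/-- `G` and all its proper subgraphs have a non-negative freedom number. -/
def IsIndependent (G : SimpleGraph V) : Prop :=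
  0 ≤ G.freedomNumber ∧ ∀ S : G.Subgraph, S.IsProper → 0 ≤ S.coe.freedomNumber

/-- A Laman (maximally independent) graph: independent with freedom number zero. -/
def IsLaman (G : SimpleGraph V) : Prop :=
  G.IsIndependent ∧ G.freedomNumber = 0

/-- A Laman graph is basic if none of its proper subgraphs is maximally independent. -/
def IsBasicLaman (G : SimpleGraph V) : Prop :=
  G.IsLaman ∧ ∀ S : G.Subgraph, S.IsProper → ¬ S.coe.IsLaman

/-- `U` separates `G`: some two vertices outside `U` are such that every walk joining them meets
`U`. (They are then distinct, because the trivial walk at a vertex outside `U` avoids `U`.) -/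
def IsSeparatedBy (G : SimpleGraph V) (U : Finset V) : Prop :=
  ∃ a b : V, a ∉ U ∧ b ∉ U ∧ ∀ w : G.Walk a b, ∃ x ∈ w.support, x ∈ U

/-- `G` has more than `m` vertices and no separating set of order `m - 1`. -/
def IsMConnected (G : SimpleGraph V) (m : ℕ) : Prop :=
  m < Nat.card V ∧ ∀ U : Finset V, U.card + 1 = m → ¬ G.IsSeparatedBy U

/-- A drawing of `G` in the Euclidean plane without edge crossings. Vertices are distinct points,
edges are simple continuous arcs joining the points of their end vertices, the interior of an arc
contains no vertex point, and the interiors of distinct arcs are disjoint. -/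
structure PlaneDrawing (G : SimpleGraph V) where
  point : V → EuclideanSpace ℝ (Fin 2)
  arc : G.edgeSet → C(unitInterval, EuclideanSpace ℝ (Fin 2))
  point_injective : Function.Injective point
  arc_injective : ∀ e, Function.Injective (arc e)
  arc_ends : ∀ e, s(arc e 0, arc e 1) = Sym2.map point (e : Sym2 V)
  arc_ne_point : ∀ e, ∀ t ∈ Set.Ioo (0 : unitInterval) 1, ∀ v, arc e t ≠ point v
  arc_ne_arc : ∀ e f, e ≠ f → ∀ s ∈ Set.Ioo (0 : unitInterval) 1,
    ∀ t ∈ Set.Ioo (0 : unitInterval) 1, arc e s ≠ arc f t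

/-- `G` can be drawn in the plane without edge crossings. -/
def IsPlanar (G : SimpleGraph V) : Prop :=
  Nonempty G.PlaneDrawing

end SimpleGraph

/-!
A separating pair of vertices splits a basic Laman graph `G` into two proper subgraphs that overlap
in two vertices. Each of them has freedom number at least `1` and their overlap has freedom number
at most `1`, so the modular law for freedom numbers makes that of `G` positive, which is absurd. A
triangle has freedom number `0`, hence is not a proper subgraph of `G`, and `G` has girth at
least `4`.

For a connected planar graph of girth `g`, each face of a drawing has at least `g` boundary edges
and each edge bounds at most two faces. Euler's inequality `e + 2 ≤ f + n` then yields
`g * (e + 2) ≤ 2 * e + g * n`, which for `g ≥ 4` contradicts `e = 2 * n - 3`.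

The topology of the plane enters through Eilenberg's criterion: a compact set `K` separates `a` from
`b` if and only if `(z - a) / (z - b)` has no continuous logarithm on `K`. Continuous logarithms on
two closed sets can be glued when their intersection is connected, and up to integer powers when
it has two components, and this controls how the faces change when an arc is added to a drawing.
-/

section ContinuousLogarithm

open Set Topology Metric

variable {X : Type*} [TopologicalSpace X]

/-- `f` has a continuous logarithm on `Z`. On compact subsets of the plane such logarithms detect
separation. The logarithm is defined on the whole space, with arbitrary values off `Z`. -/
def HasLogOn (f : X → ℂ) (Z : Set X) : Prop :=
  ∃ g : X → ℂ, ContinuousOn g Z ∧ ∀ z ∈ Z, Complex.exp (g z) = f z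

namespace HasLogOn

variable {f f₁ f₂ : X → ℂ} {Z Z' : Set X}

lemma mono (h : HasLogOn f Z) (hZ : Z' ⊆ Z) : HasLogOn f Z' := by
  obtain ⟨g, hg, exp_g⟩ := h
  exact ⟨g, hg.mono hZ, fun z hz => exp_g z (hZ hz)⟩

lemma congr (h : HasLogOn f₁ Z) (hf : EqOn f₁ f₂ Z) : HasLogOn f₂ Z := by
  obtain ⟨g, hg, exp_g⟩ := h
  exact ⟨g, hg, fun z hz => (exp_g z hz).trans (hf hz)⟩

lemma mul (h₁ : HasLogOn f₁ Z) (h₂ : HasLogOn f₂ Z) : HasLogOn (fun z => f₁ z * f₂ z) Z := by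
  obtain ⟨g₁, hg₁, exp_g₁⟩ := h₁
  obtain ⟨g₂, hg₂, exp_g₂⟩ := h₂
  refine ⟨fun z => g₁ z + g₂ z, hg₁.add hg₂, fun z hz => ?_⟩
  rw [Complex.exp_add, exp_g₁ z hz, exp_g₂ z hz]

end HasLogOn

lemma hasLogOn_of_subsingleton {f : X → ℂ} {Z : Set X} (hZ : Z.Subsingleton)
    (f_ne_zero : ∀ z ∈ Z, f z ≠ 0) : HasLogOn f Z :=
  ⟨fun z => Complex.log (f z), hZ.continuousOn _, fun z hz => Complex.exp_log (f_ne_zero z hz)⟩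

lemma hasLogOn_iff_exists_continuousMap {f : X → ℂ} {Z : Set X} :
    HasLogOn f Z ↔ ∃ g : C(Z, ℂ), ∀ z : Z, Complex.exp (g z) = f z := by
  constructor
  · rintro ⟨g, hg, exp_g⟩
    exact ⟨⟨Z.domRestrict g, hg.domRestrict⟩, fun z => exp_g z z.2⟩
  · rintro ⟨g, exp_g⟩
    have restrict_extend : Z.domRestrict (Subtype.val.extend g 0) = g :=
      funext fun z => Subtype.val_injective.extend_apply g 0 z
    refine ⟨Subtype.val.extend g 0, ?_, fun z hz => ?_⟩
    · rw [continuousOn_iff_continuous_domRestrict, restrict_extend]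
      exact g.continuous
    · exact congrArg Complex.exp (congrFun restrict_extend ⟨z, hz⟩) |>.trans (exp_g ⟨z, hz⟩)

lemma exists_log_of_homotopic {f₀ f₁ : C(X, {z : ℂ // z ≠ 0})} (h : f₀.Homotopic f₁)
    (g₀ : C(X, ℂ)) (exp_g₀ : ∀ x, Complex.exp (g₀ x) = f₀ x) :
    ∃ g₁ : C(X, ℂ), ∀ x, Complex.exp (g₁ x) = f₁ x := by
  obtain ⟨H⟩ := h
  have H_zero : ∀ x, H (0, x) = ⟨Complex.exp (g₀ x), Complex.exp_ne_zero _⟩ := fun x =>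
    Subtype.ext ((congrArg Subtype.val (H.apply_zero x)).trans (exp_g₀ x).symm)
  let lift := Complex.isCoveringMap_exp.liftHomotopy (H : C(unitInterval × X, _)) g₀ H_zero
  refine ⟨lift.comp ⟨fun x => (1, x), by fun_prop⟩, fun x => ?_⟩
  have exp_lift := congrArg Subtype.val
    (congrFun (Complex.isCoveringMap_exp.liftHomotopy_lifts _ g₀ H_zero) (1, x))
  exact exp_lift.trans (congrArg Subtype.val (H.apply_one x))

lemma exists_log_of_contractibleSpace [ContractibleSpace X] (f : C(X, {z : ℂ // z ≠ 0})) :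
    ∃ g : C(X, ℂ), ∀ x, Complex.exp (g x) = f x := by
  obtain ⟨c, hc⟩ := (id_nullhomotopic X).comp_right f
  exact exists_log_of_homotopic hc.symm (.const X (Complex.log c)) fun _ => Complex.exp_log c.2

lemma hasLogOn_of_contractibleSpace {f : X → ℂ} {Z : Set X} [ContractibleSpace Z]
    (hf : ContinuousOn f Z) (f_ne_zero : ∀ z ∈ Z, f z ≠ 0) : HasLogOn f Z :=
  hasLogOn_iff_exists_continuousMap.2 <| exists_log_of_contractibleSpace
    (⟨fun z => ⟨f z, f_ne_zero z z.2⟩, hf.domRestrict.subtype_mk _⟩ : C(Z, {z : ℂ // z ≠ 0}))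

lemma hasLogOn_closedBall {E : Type*} [NormedAddCommGroup E] [NormedSpace ℝ E] {f : E → ℂ}
    {p : E} {R : ℝ} (hR : 0 ≤ R) (hf : ContinuousOn f (closedBall p R))
    (f_ne_zero : ∀ z ∈ closedBall p R, f z ≠ 0) : HasLogOn f (closedBall p R) :=
  have := (convex_closedBall p R).contractibleSpace ⟨p, mem_closedBall_self hR⟩
  hasLogOn_of_contractibleSpace hf f_ne_zero

lemma hasLogOn_range_of_injective [T2Space X] {α : C(unitInterval, X)}
    (hα : Function.Injective α) {f : X → ℂ} (hf : ContinuousOn f (range α))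
    (f_ne_zero : ∀ z ∈ range α, f z ≠ 0) : HasLogOn f (range α) := by
  have : ContractibleSpace unitInterval := (convex_Icc (0 : ℝ) 1).contractibleSpace ⟨0, by simp⟩
  have : ContractibleSpace (range α) :=
    (α.continuous.isClosedEmbedding hα).isEmbedding.toHomeomorph.symm.contractibleSpace
  exact hasLogOn_of_contractibleSpace hf f_ne_zero

lemma hasLogOn_sub_div_sub_of_joinedIn {S : Set ℂ} {a b : ℂ} (h : JoinedIn S a b) :
    HasLogOn (fun z => (z - a) / (z - b)) Sᶜ := by
  obtain ⟨γ, γ_mem⟩ := h.symm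
  have sub_ne_zero_of_mem (z : ↥Sᶜ) {w : ℂ} (hw : w ∈ S) : (z : ℂ) - w ≠ 0 := fun hzw =>
    z.2 (sub_eq_zero.1 hzw ▸ hw)
  have sub_b_ne_zero (z : ↥Sᶜ) : (z : ℂ) - b ≠ 0 := sub_ne_zero_of_mem z h.target_mem
  have hf : Continuous fun z : ↥Sᶜ => ((z : ℂ) - a) / ((z : ℂ) - b) :=
    .div (by fun_prop) (by fun_prop) sub_b_ne_zero
  have hH : Continuous fun x : unitInterval × ↥Sᶜ => ((x.2 : ℂ) - γ x.1) / ((x.2 : ℂ) - b) :=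
    .div (by fun_prop) (by fun_prop) fun x => sub_b_ne_zero x.2
  let f : C(↥Sᶜ, {z : ℂ // z ≠ 0}) := ⟨_, hf.subtype_mk fun z =>
    div_ne_zero (sub_ne_zero_of_mem z h.source_mem) (sub_b_ne_zero z)⟩
  let H : C(unitInterval × ↥Sᶜ, {z : ℂ // z ≠ 0}) := ⟨_, hH.subtype_mk fun x =>
    div_ne_zero (sub_ne_zero_of_mem x.2 (γ_mem x.1)) (sub_b_ne_zero x.2)⟩
  have homotopic : ContinuousMap.Homotopic (.const _ ⟨1, one_ne_zero⟩) f :=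
    ⟨⟨H, fun z => Subtype.ext (by simp [H, div_self (sub_b_ne_zero z)]),
      fun z => Subtype.ext (by simp [H, f])⟩⟩
  exact hasLogOn_iff_exists_continuousMap.2 <|
    exists_log_of_homotopic homotopic (.const _ 0) fun _ => Complex.exp_zero

/-- Two continuous logarithms of one function differ by a constant on a preconnected set because
the exponential is a covering map. -/
lemma exists_eq_add_int_mul_of_exp_eq {S : Set X} (hS : IsPreconnected S) {g h : X → ℂ}
    (hg : ContinuousOn g S) (hh : ContinuousOn h S)
    (exp_eq : ∀ z ∈ S, Complex.exp (h z) = Complex.exp (g z)) :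
    ∃ n : ℤ, ∀ z ∈ S, h z = g z + n * (2 * Real.pi * Complex.I) := by
  rcases S.eq_empty_or_nonempty with rfl | ⟨x, hx⟩
  · exact ⟨0, by simp⟩
  obtain ⟨n, hn⟩ := Complex.exp_eq_exp_iff_exists_int.1 (exp_eq x hx)
  refine ⟨n, Complex.isCoveringMap_exp.eqOn_of_comp_eqOn hS hh (hg.add continuousOn_const)
    (fun z hz => Subtype.ext ?_) hx hn⟩
  simp [Complex.exp_add, Complex.exp_int_mul_two_pi_mul_I, exp_eq z hz]

lemma hasLogOn_union_of_eq_add_int_mul {U V : Set X} {f g h : X → ℂ}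
    (glue : ∀ φ : X → ℂ, ContinuousOn φ U → ContinuousOn φ V → ContinuousOn φ (U ∪ V))
    (hg : ContinuousOn g U) (exp_g : ∀ z ∈ U, Complex.exp (g z) = f z)
    (hh : ContinuousOn h V) (exp_h : ∀ z ∈ V, Complex.exp (h z) = f z)
    (hgh : ∃ n : ℤ, ∀ z ∈ U ∩ V, h z = g z + n * (2 * Real.pi * Complex.I)) :
    HasLogOn f (U ∪ V) := by
  classical
  obtain ⟨n, hn⟩ := hgh
  let g' : X → ℂ := fun z => g z + n * (2 * Real.pi * Complex.I)
  have eqOn_V : EqOn (U.piecewise g' h) h V := fun z hzV => by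
    by_cases hzU : z ∈ U
    · rw [U.piecewise_eq_of_mem _ _ hzU, hn z ⟨hzU, hzV⟩]
    · exact U.piecewise_eq_of_notMem _ _ hzU
  have eqOn_U : EqOn (U.piecewise g' h) g' U := U.piecewise_eqOn _ _
  refine ⟨U.piecewise g' h, glue _ ((hg.add continuousOn_const).congr eqOn_U) (hh.congr eqOn_V), ?_⟩
  rintro z (hz | hz)
  · rw [eqOn_U hz, Complex.exp_add, Complex.exp_int_mul_two_pi_mul_I, mul_one, exp_g z hz]
  · rw [eqOn_V hz, exp_h z hz]

lemma exists_mul_add_mul_eq_mul_add_mul {R : Type*} [CommRing R] [Nontrivial R]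
    (a₁ a₂ b₁ b₂ : R) :
    ∃ k l : R, (k ≠ 0 ∨ l ≠ 0) ∧ k * a₁ + l * a₂ = k * b₁ + l * b₂ := by
  by_cases h : a₂ = b₂
  · exact ⟨0, 1, by simp, by simp [h]⟩
  · exact ⟨b₂ - a₂, a₁ - b₁, .inl (sub_ne_zero.2 (Ne.symm h)), by ring⟩

namespace HasLogOn

lemma union_of_isOpen {f : X → ℂ} {U V : Set X} (hU : IsOpen U) (hV : IsOpen V)
    (hUV : IsPreconnected (U ∩ V)) (fU : HasLogOn f U) (fV : HasLogOn f V) :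
    HasLogOn f (U ∪ V) := by
  obtain ⟨g, hg, exp_g⟩ := fU
  obtain ⟨h, hh, exp_h⟩ := fV
  exact hasLogOn_union_of_eq_add_int_mul (fun _ hφU hφV => hφU.union_of_isOpen hφV hU hV)
    hg exp_g hh exp_h <| exists_eq_add_int_mul_of_exp_eq hUV (hg.mono inter_subset_left)
      (hh.mono inter_subset_right) fun z hz => (exp_h z hz.2).trans (exp_g z hz.1).symm

lemma union_of_isClosed {f : X → ℂ} {K A : Set X} (hK : IsClosed K) (hA : IsClosed A)
    (hKA : IsPreconnected (K ∩ A)) (fK : HasLogOn f K) (fA : HasLogOn f A) :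
    HasLogOn f (K ∪ A) := by
  obtain ⟨g, hg, exp_g⟩ := fK
  obtain ⟨h, hh, exp_h⟩ := fA
  exact hasLogOn_union_of_eq_add_int_mul (fun _ hφK hφA => hφK.union_of_isClosed hφA hK hA)
    hg exp_g hh exp_h <| exists_eq_add_int_mul_of_exp_eq hKA (hg.mono inter_subset_left)
      (hh.mono inter_subset_right) fun z hz => (exp_h z hz.2).trans (exp_g z hz.1).symm

lemma exists_zpow_mul_zpow_union {f₁ f₂ : X → ℂ} {K A : Set X} (hK : IsClosed K)
    (hA : IsClosed A) {a b : X} (hKA : K ∩ A = {a, b}) (f₁K : HasLogOn f₁ K)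
    (f₁A : HasLogOn f₁ A) (f₂K : HasLogOn f₂ K) (f₂A : HasLogOn f₂ A) :
    ∃ k l : ℤ, (k ≠ 0 ∨ l ≠ 0) ∧ HasLogOn (fun z => f₁ z ^ k * f₂ z ^ l) (K ∪ A) := by
  obtain ⟨g₁, hg₁, exp_g₁⟩ := f₁K
  obtain ⟨h₁, hh₁, exp_h₁⟩ := f₁A
  obtain ⟨g₂, hg₂, exp_g₂⟩ := f₂K
  obtain ⟨h₂, hh₂, exp_h₂⟩ := f₂A
  have ha : a ∈ K ∩ A := by simp [hKA]
  have hb : b ∈ K ∩ A := by simp [hKA]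
  have exp_eq₁ : ∀ z ∈ K ∩ A, Complex.exp (h₁ z) = Complex.exp (g₁ z) := fun z hz =>
    (exp_h₁ z hz.2).trans (exp_g₁ z hz.1).symm
  have exp_eq₂ : ∀ z ∈ K ∩ A, Complex.exp (h₂ z) = Complex.exp (g₂ z) := fun z hz =>
    (exp_h₂ z hz.2).trans (exp_g₂ z hz.1).symm
  obtain ⟨a₁, ha₁⟩ := Complex.exp_eq_exp_iff_exists_int.1 (exp_eq₁ a ha)
  obtain ⟨b₁, hb₁⟩ := Complex.exp_eq_exp_iff_exists_int.1 (exp_eq₁ b hb)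
  obtain ⟨a₂, ha₂⟩ := Complex.exp_eq_exp_iff_exists_int.1 (exp_eq₂ a ha)
  obtain ⟨b₂, hb₂⟩ := Complex.exp_eq_exp_iff_exists_int.1 (exp_eq₂ b hb)
  obtain ⟨k, l, hkl, balanced⟩ := exists_mul_add_mul_eq_mul_add_mul a₁ a₂ b₁ b₂
  refine ⟨k, l, hkl, hasLogOn_union_of_eq_add_int_mul
    (fun _ hφK hφA => hφK.union_of_isClosed hφA hK hA)
    (g := fun z => k * g₁ z + l * g₂ z) (h := fun z => k * h₁ z + l * h₂ z)
    (by fun_prop) (fun z hz => ?_) (by fun_prop) (fun z hz => ?_) ⟨k * a₁ + l * a₂, ?_⟩⟩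
  · simp only [Complex.exp_add, Complex.exp_int_mul, exp_g₁ z hz, exp_g₂ z hz]
  · simp only [Complex.exp_add, Complex.exp_int_mul, exp_h₁ z hz, exp_h₂ z hz]
  · rw [hKA]
    rintro z (rfl | rfl)
    · rw [ha₁, ha₂]
      push_cast
      ring
    · rw [hb₁, hb₂, balanced]
      push_cast
      ring

end HasLogOn

end ContinuousLogarithm

section PlaneSeparation

open Set Topology Metric

lemma eq_zero_of_hasLogOn_zpow_sphere {p : ℂ} {R : ℝ} (hR : 0 < R) {k : ℤ}
    (h : HasLogOn (fun z => (z - p) ^ k) (sphere p R)) : k = 0 := by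
  obtain ⟨g, hg, exp_g⟩ := h
  let l : ℝ → ℂ := fun θ => k * (Real.log R + θ * Complex.I)
  have exp_l (θ : ℝ) : Complex.exp (l θ) = (circleMap p R θ - p) ^ k := by
    simp [l, circleMap, Complex.exp_int_mul, Complex.exp_add, ← Complex.ofReal_exp,
      Real.exp_log hR]
  have circle_mem (θ : ℝ) : circleMap p R θ ∈ sphere p R := circleMap_mem_sphere p hR.le θ
  obtain ⟨n, hn⟩ := exists_eq_add_int_mul_of_exp_eq isPreconnected_univ (g := g ∘ circleMap p R)
    (hg.comp (continuous_circleMap p R).continuousOn fun θ _ => circle_mem θ)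
    (show ContinuousOn l univ by fun_prop)
    fun θ _ => (exp_l θ).trans (exp_g _ (circle_mem θ)).symm
  have l_two_pi : l (2 * Real.pi) = l 0 := by
    simp only [hn _ trivial, Function.comp_apply, circleMap]
    simp
  have winding : (k : ℂ) * (2 * Real.pi * Complex.I) = 0 := by
    simp only [l] at l_two_pi
    push_cast at l_two_pi
    linear_combination l_two_pi
  simpa [Complex.two_pi_I_ne_zero] using winding

lemma eq_zero_of_hasLogOn_zpow_mul_sphere {p : ℂ} {R : ℝ} (hR : 0 < R) {k : ℤ} {r : ℂ → ℂ}
    (hr : ContinuousOn r (closedBall p R)) (r_ne_zero : ∀ z ∈ closedBall p R, r z ≠ 0)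
    (h : HasLogOn (fun z => (z - p) ^ k * r z) (sphere p R)) : k = 0 := by
  have log_inv_r : HasLogOn (fun z => (r z)⁻¹) (sphere p R) :=
    (hasLogOn_closedBall hR.le (hr.inv₀ r_ne_zero)
      fun z hz => inv_ne_zero (r_ne_zero z hz)).mono sphere_subset_closedBall
  exact eq_zero_of_hasLogOn_zpow_sphere hR <| (h.mul log_inv_r).congr fun z hz =>
    mul_inv_cancel_right₀ (r_ne_zero z (sphere_subset_closedBall hz)) _

lemma HasLogOn.exists_continuous_extension {X : Type*} [TopologicalSpace X] [NormalSpace X]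
    {f : X → ℂ} {K : Set X} (hK : IsClosed K) (hf : HasLogOn f K) :
    ∃ F : X → ℂ, Continuous F ∧ (∀ z, F z ≠ 0) ∧ EqOn F f K := by
  obtain ⟨g, exp_g⟩ := hasLogOn_iff_exists_continuousMap.1 hf
  obtain ⟨G, hG⟩ := ContinuousMap.exists_restrict_eq hK g
  refine ⟨fun z => Complex.exp (G z), by fun_prop, fun z => Complex.exp_ne_zero _, fun z hz => ?_⟩
  have G_eq_g : G z = g ⟨z, hz⟩ := DFunLike.congr_fun hG ⟨z, hz⟩
  exact (congrArg Complex.exp G_eq_g).trans (exp_g ⟨z, hz⟩)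

/-- An extension of `(z - p) ^ k * r z` from `frontier U` to a nowhere vanishing function on
`closure U`, divided by `r`, fits together with `(z - p) ^ k` off `U`. -/
lemma eq_zero_of_hasLogOn_zpow_mul_frontier {U : Set ℂ} (hU : IsOpen U)
    (bdd : Bornology.IsBounded U) {p : ℂ} (hp : p ∈ U) {k : ℤ} {r : ℂ → ℂ}
    (hr : ContinuousOn r (closure U)) (r_ne_zero : ∀ z ∈ closure U, r z ≠ 0)
    (h : HasLogOn (fun z => (z - p) ^ k * r z) (frontier U)) : k = 0 := by
  classical
  obtain ⟨F, hF, F_ne_zero, F_eq⟩ := h.exists_continuous_extension isClosed_frontier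
  have sub_ne_zero_of_notMem {z : ℂ} (hz : z ∉ U) : z - p ≠ 0 := fun hzp =>
    hz (sub_eq_zero.1 hzp ▸ hp)
  let Φ : ℂ → ℂ := U.piecewise (fun z => F z / r z) fun z => (z - p) ^ k
  have hΦ : Continuous Φ := by
    refine continuous_piecewise (fun z hz => ?_) (hF.continuousOn.div hr r_ne_zero) ?_
    · rw [F_eq hz, mul_div_cancel_right₀ _ (r_ne_zero z (frontier_subset_closure hz))]
    · rw [hU.isClosed_compl.closure_eq]
      exact ContinuousOn.zpow₀ (by fun_prop) k fun z hz => .inl (sub_ne_zero_of_notMem hz)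
  have Φ_ne_zero (z : ℂ) : Φ z ≠ 0 := by
    by_cases hz : z ∈ U
    · simpa only [Φ, piecewise_eq_of_mem _ _ _ hz] using
        div_ne_zero (F_ne_zero z) (r_ne_zero z (subset_closure hz))
    · simpa only [Φ, piecewise_eq_of_notMem _ _ _ hz] using
        zpow_ne_zero k (sub_ne_zero_of_notMem hz)
  obtain ⟨R, hR, U_subset⟩ := bdd.subset_ball_lt 0 p
  have log_Φ : HasLogOn Φ (sphere p R) :=
    (hasLogOn_closedBall hR.le hΦ.continuousOn fun z _ => Φ_ne_zero z).mono
      sphere_subset_closedBall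
  exact eq_zero_of_hasLogOn_zpow_sphere hR <| log_Φ.congr fun z hz =>
    piecewise_eq_of_notMem _ _ _ fun hzU => (mem_ball.1 (U_subset hzU)).ne (mem_sphere.1 hz)

lemma frontier_connectedComponentIn_compl_subset {X : Type*} [TopologicalSpace X]
    [LocallyConnectedSpace X] {K : Set X} (hK : IsClosed K) (p : X) :
    frontier (connectedComponentIn Kᶜ p) ⊆ K := by
  rintro x ⟨x_mem_closure, x_notMem_interior⟩
  by_contra hx
  obtain ⟨y, hyx, hyp⟩ := mem_closure_iff.1 x_mem_closure _
    (hK.isOpen_compl.connectedComponentIn (x := x)) (mem_connectedComponentIn hx)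
  rw [hK.isOpen_compl.connectedComponentIn.interior_eq, connectedComponentIn_eq hyp,
    ← connectedComponentIn_eq hyx] at x_notMem_interior
  exact x_notMem_interior (mem_connectedComponentIn hx)

lemma isPreconnected_setOf_lt_norm {r : ℝ} (hr : 0 < r) : IsPreconnected {z : ℂ | r < ‖z‖} := by
  have eq_exp_image : {z : ℂ | r < ‖z‖} = Complex.exp '' {w | Real.log r < w.re} := by
    ext z
    constructor
    · intro (hz : r < ‖z‖)
      exact ⟨Complex.log z, by simpa [Complex.log_re] using Real.log_lt_log hr hz,
        Complex.exp_log (norm_pos_iff.1 (hr.trans hz))⟩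
    · rintro ⟨w, hw, rfl⟩
      simpa [Complex.norm_exp] using (Real.log_lt_iff_lt_exp hr).1 hw
  rw [eq_exp_image]
  exact (convex_halfSpace_re_gt _).isPreconnected.image _ Complex.continuous_exp.continuousOn

lemma connectedComponentIn_compl_eq_of_not_isBounded {K : Set ℂ} (hK : Bornology.IsBounded K)
    {p q : ℂ} (hp : ¬ Bornology.IsBounded (connectedComponentIn Kᶜ p))
    (hq : ¬ Bornology.IsBounded (connectedComponentIn Kᶜ q)) :
    connectedComponentIn Kᶜ p = connectedComponentIn Kᶜ q := by
  obtain ⟨r, hr, K_subset⟩ := hK.subset_closedBall_lt 0 0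
  have exterior_subset : {z : ℂ | r < ‖z‖} ⊆ Kᶜ := fun z (hz : r < ‖z‖) hzK =>
    (mem_closedBall_zero_iff.1 (K_subset hzK)).not_gt hz
  have exterior_subset_of_not_isBounded {x : ℂ}
      (hx : ¬ Bornology.IsBounded (connectedComponentIn Kᶜ x)) :
      {z : ℂ | r < ‖z‖} ⊆ connectedComponentIn Kᶜ x := by
    obtain ⟨z, hz, hzr⟩ : ∃ z ∈ connectedComponentIn Kᶜ x, r < ‖z‖ := by
      by_contra! h
      exact hx (isBounded_closedBall.subset fun z hz => mem_closedBall_zero_iff.2 (h z hz))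
    rw [connectedComponentIn_eq hz]
    exact (isPreconnected_setOf_lt_norm hr).subset_connectedComponentIn hzr exterior_subset
  obtain ⟨w, hw⟩ := NormedSpace.exists_lt_norm ℝ ℂ r
  exact (connectedComponentIn_eq (exterior_subset_of_not_isBounded hp hw)).trans
    (connectedComponentIn_eq (exterior_subset_of_not_isBounded hq hw)).symm

lemma eq_zero_of_hasLogOn_prod_zpow {ι : Type*} [Fintype ι] {K : Set ℂ} (hK : IsCompact K)
    {p : ι → ℂ} (hp : ∀ i, p i ∉ K)
    (hinj : Function.Injective fun i => connectedComponentIn Kᶜ (p i)) {k : ι → ℤ}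
    (hk : ∑ i, k i = 0) (h : HasLogOn (fun z => ∏ i, (z - p i) ^ k i) K) : k = 0 := by
  classical
  have eq_zero_of_isBounded (i : ι)
      (bdd : Bornology.IsBounded (connectedComponentIn Kᶜ (p i))) : k i = 0 := by
    have frontier_subset := frontier_connectedComponentIn_compl_subset hK.isClosed (p i)
    have sub_ne_zero_of_ne : ∀ j ∈ Finset.univ.erase i,
        ∀ z ∈ closure (connectedComponentIn Kᶜ (p i)), z - p j ≠ 0 := by
      intro j hj z hz hzp
      rw [sub_eq_zero.1 hzp, closure_eq_self_union_frontier] at hz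
      exact hz.elim (fun hz => Finset.ne_of_mem_erase hj (hinj (connectedComponentIn_eq hz)).symm)
        fun hz => hp j (frontier_subset hz)
    refine eq_zero_of_hasLogOn_zpow_mul_frontier hK.isClosed.isOpen_compl.connectedComponentIn bdd
      (mem_connectedComponentIn (hp i)) (r := fun z => ∏ j ∈ Finset.univ.erase i, (z - p j) ^ k j)
      (continuousOn_finsetProd _ fun j hj => .zpow₀ (by fun_prop) _ fun z hz =>
        .inl (sub_ne_zero_of_ne j hj z hz))
      (fun z hz => Finset.prod_ne_zero_iff.2 fun j hj =>
        zpow_ne_zero _ (sub_ne_zero_of_ne j hj z hz)) ((h.mono frontier_subset).congr fun z _ => ?_)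
    exact (Finset.mul_prod_erase _ _ (Finset.mem_univ i)).symm
  funext i
  by_contra hi
  refine hi (.trans (Finset.sum_eq_single i (fun j _ hji => ?_) (by simp)).symm hk)
  by_contra hj
  exact hji (hinj (connectedComponentIn_compl_eq_of_not_isBounded hK.isBounded
    (mt (eq_zero_of_isBounded j) hj) (mt (eq_zero_of_isBounded i) hi)))

/-- **Eilenberg's criterion** -/
lemma hasLogOn_sub_div_sub_iff {K : Set ℂ} (hK : IsCompact K) {p q : ℂ} (hp : p ∉ K)
    (hq : q ∉ K) : HasLogOn (fun z => (z - p) / (z - q)) K ↔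
      connectedComponentIn Kᶜ p = connectedComponentIn Kᶜ q := by
  constructor
  · intro h
    by_contra hpq
    have : (![1, -1] : Fin 2 → ℤ) = 0 := eq_zero_of_hasLogOn_prod_zpow hK (p := ![p, q])
      (by simp [Fin.forall_fin_two, hp, hq])
      (by simp [Function.Injective, Fin.forall_fin_two, hpq, Ne.symm hpq]) (by simp)
      (h.congr fun z _ => by simp [div_eq_mul_inv])
    exact one_ne_zero (congrFun this 0)
  · intro hpq
    have path_connected : IsPathConnected (connectedComponentIn Kᶜ p) :=
      hK.isClosed.isOpen_compl.connectedComponentIn.isConnected_iff_isPathConnected.1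
        (isConnected_connectedComponentIn_iff.2 hp)
    have joined : JoinedIn Kᶜ p q := (path_connected.joinedIn p (mem_connectedComponentIn hp) q
      (hpq ▸ mem_connectedComponentIn hq)).mono (connectedComponentIn_subset _ _)
    simpa only [compl_compl] using hasLogOn_sub_div_sub_of_joinedIn joined

/-- `(z - a) / (z - b)` has a logarithm on `W` and on `Aᶜ`. If `W ∩ Aᶜ` were preconnected, then it
would have one on `W ∪ Aᶜ`, which contains a circle around `a` inside which `b` does not lie. -/
lemma not_isPreconnected_sdiff_of_joinedIn {W A : Set ℂ} (hW : IsOpen W) (hA : IsClosed A)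
    {a b : ℂ} (hab : a ≠ b) (joined_compl : JoinedIn Wᶜ a b) (joined_A : JoinedIn A a b)
    (sdiff_subset : A \ {a, b} ⊆ W) : ¬ IsPreconnected (W \ A) := by
  intro preconnected
  have log_W : HasLogOn (fun z => (z - a) / (z - b)) W := by
    simpa only [compl_compl] using hasLogOn_sub_div_sub_of_joinedIn joined_compl
  have log_union : HasLogOn (fun z => (z - a) / (z - b)) (W ∪ Aᶜ) :=
    log_W.union_of_isOpen hW hA.isOpen_compl preconnected
      (hasLogOn_sub_div_sub_of_joinedIn joined_A)
  have dist_pos : 0 < dist b a := dist_pos.2 hab.symm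
  have b_notMem : b ∉ closedBall a (dist b a / 2) := fun hb => by
    linarith [mem_closedBall.1 hb]
  have sub_ne_zero_of_mem : ∀ z ∈ closedBall a (dist b a / 2), z - b ≠ 0 := fun z hz hzb =>
    b_notMem (sub_eq_zero.1 hzb ▸ hz)
  have sphere_subset : sphere a (dist b a / 2) ⊆ W ∪ Aᶜ := by
    intro z hz
    by_cases hzA : z ∈ A
    · refine .inl (sdiff_subset ⟨hzA, ?_⟩)
      rintro (rfl | rfl)
      · exact (half_pos dist_pos).ne (by simpa using hz)
      · exact b_notMem (sphere_subset_closedBall hz)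
    · exact .inr hzA
  exact one_ne_zero <| eq_zero_of_hasLogOn_zpow_mul_sphere (half_pos dist_pos)
    (ContinuousOn.inv₀ (by fun_prop) sub_ne_zero_of_mem)
    (fun z hz => inv_ne_zero (sub_ne_zero_of_mem z hz))
    ((log_union.mono sphere_subset).congr fun z _ => by simp [div_eq_mul_inv])

/-- The set of connected components of the complement of `K`, as subsets of the whole space. -/
def complementComponents {X : Type*} [TopologicalSpace X] (K : Set X) : Set (Set X) :=
  connectedComponentIn Kᶜ '' Kᶜ

lemma mem_complementComponents {X : Type*} [TopologicalSpace X] {K : Set X} {p : X}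
    (hp : p ∉ K) : connectedComponentIn Kᶜ p ∈ complementComponents K :=
  mem_image_of_mem _ hp

lemma encard_image_le_encard_image_of_factorsOn {α β γ : Type*} {f : α → β} {g : α → γ} {S : Set α}
    (h : ∀ x ∈ S, ∀ y ∈ S, g x = g y → f x = f y) : (f '' S).encard ≤ (g '' S).encard := by
  rcases S.eq_empty_or_nonempty with rfl | ⟨x₀, -⟩
  · simp
  have : Nonempty α := ⟨x₀⟩
  have image_eq : (f ∘ Function.invFunOn g S) '' (g '' S) = f '' S := by
    rw [image_image]
    refine image_congr fun x hx => ?_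
    have hgx : ∃ y ∈ S, g y = g x := ⟨x, hx, rfl⟩
    exact h _ (Function.invFunOn_mem hgx) x hx (Function.invFunOn_eq hgx)
  exact image_eq ▸ encard_image_le _ _

lemma encard_complementComponents_add_one_le {X : Type*} [TopologicalSpace X] {K A : Set X}
    {p q : X} (sdiff_nonempty : ∀ x ∉ K, (connectedComponentIn Kᶜ x \ A).Nonempty)
    (hp : p ∉ K ∪ A) (hq : q ∉ K ∪ A)
    (same : connectedComponentIn Kᶜ p = connectedComponentIn Kᶜ q)
    (separated : connectedComponentIn (K ∪ A)ᶜ p ≠ connectedComponentIn (K ∪ A)ᶜ q) :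
    (complementComponents K).encard + 1 ≤ (complementComponents (K ∪ A)).encard := by
  have eq_of_eq {x y : X} (hx : x ∉ K ∪ A)
      (hxy : connectedComponentIn (K ∪ A)ᶜ x = connectedComponentIn (K ∪ A)ᶜ y) :
      connectedComponentIn Kᶜ x = connectedComponentIn Kᶜ y :=
    (connectedComponentIn_eq <| connectedComponentIn_mono y
      (compl_subset_compl.2 subset_union_left) (hxy ▸ mem_connectedComponentIn hx)).symm
  let S : Set X :=
    {x | x ∉ K ∪ A ∧ connectedComponentIn (K ∪ A)ᶜ x ≠ connectedComponentIn (K ∪ A)ᶜ q}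
  have components_subset : complementComponents K ⊆ connectedComponentIn Kᶜ '' S := by
    rintro _ ⟨x, hx, rfl⟩
    by_cases hxq : connectedComponentIn Kᶜ x = connectedComponentIn Kᶜ q
    · exact ⟨p, ⟨hp, separated⟩, same.trans hxq.symm⟩
    · obtain ⟨y, hy, hyA⟩ := sdiff_nonempty x hx
      have hyKA : y ∉ K ∪ A := not_or.2 ⟨connectedComponentIn_subset _ _ hy, hyA⟩
      have hyx : connectedComponentIn Kᶜ y = connectedComponentIn Kᶜ x :=
        (connectedComponentIn_eq hy).symm
      exact ⟨y, ⟨hyKA, fun hyq => hxq (hyx.symm.trans (eq_of_eq hyKA hyq))⟩, hyx⟩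
  have image_subset : connectedComponentIn (K ∪ A)ᶜ '' S ⊆
      complementComponents (K ∪ A) \ {connectedComponentIn (K ∪ A)ᶜ q} := by
    rintro _ ⟨x, ⟨hx, hxq⟩, rfl⟩
    exact ⟨mem_complementComponents hx, hxq⟩
  rw [← encard_sdiff_singleton_add_one (mem_complementComponents hq)]
  refine add_le_add ?_ le_rfl
  exact (encard_le_encard components_subset).trans <|
    (encard_image_le_encard_image_of_factorsOn fun x hx y _ => eq_of_eq hx.1).trans
      (encard_le_encard image_subset)

lemma encard_complementComponents_add_one_le_of_joinedIn {K A : Set ℂ} (hK : IsClosed K)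
    (hA : IsClosed A) {a b x : ℂ} (hab : a ≠ b) (joined_K : JoinedIn K a b)
    (joined_A : JoinedIn A a b) (sdiff_subset : A \ {a, b} ⊆ connectedComponentIn Kᶜ x) :
    (complementComponents K).encard + 1 ≤ (complementComponents (K ∪ A)).encard := by
  set W := connectedComponentIn Kᶜ x
  have W_subset : W ⊆ Kᶜ := connectedComponentIn_subset _ _
  have notMem {z : ℂ} (hz : z ∈ W \ A) : z ∉ K ∪ A := not_or.2 ⟨W_subset hz.1, hz.2⟩
  have not_preconnected : ¬ IsPreconnected (W \ A) :=
    not_isPreconnected_sdiff_of_joinedIn hK.isOpen_compl.connectedComponentIn hA hab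
      (joined_K.mono (subset_compl_comm.1 W_subset)) joined_A sdiff_subset
  obtain ⟨p, hp, q, hq, separated⟩ : ∃ p ∈ W \ A, ∃ q ∈ W \ A,
      connectedComponentIn (K ∪ A)ᶜ p ≠ connectedComponentIn (K ∪ A)ᶜ q := by
    by_contra! same
    refine not_preconnected (isPreconnected_of_forall_pair fun p hp q hq =>
      ⟨connectedComponentIn (K ∪ A)ᶜ p, fun z hz => ⟨?_, ?_⟩,
        mem_connectedComponentIn (notMem hp), same p hp q hq ▸ mem_connectedComponentIn (notMem hq),
        isPreconnected_connectedComponentIn⟩)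
    · rw [show W = connectedComponentIn Kᶜ p from connectedComponentIn_eq hp.1]
      exact connectedComponentIn_mono p (compl_subset_compl.2 subset_union_left) hz
    · exact fun hzA => connectedComponentIn_subset _ _ hz (.inr hzA)
  refine encard_complementComponents_add_one_le (fun y hy => ?_) (notMem hp) (notMem hq)
    ((connectedComponentIn_eq hp.1).symm.trans (connectedComponentIn_eq hq.1)) separated
  by_cases hyp : p ∈ connectedComponentIn Kᶜ y
  · exact ⟨p, hyp, hp.2⟩
  · refine ⟨y, mem_connectedComponentIn hy, fun hyA => hyp ?_⟩
    have hyW : y ∈ W := sdiff_subset ⟨hyA, ?_⟩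
    · exact connectedComponentIn_eq hyW ▸ hp.1
    · rintro (rfl | rfl)
      · exact hy joined_K.source_mem
      · exact hy joined_K.target_mem

lemma eq_zero_of_hasLogOn_zpow_mul_zpow {K : Set ℂ} (hK : IsCompact K) {p q s : ℂ} (hp : p ∉ K)
    (hq : q ∉ K) (hs : s ∉ K) (hpq : connectedComponentIn Kᶜ p ≠ connectedComponentIn Kᶜ q)
    (hps : connectedComponentIn Kᶜ p ≠ connectedComponentIn Kᶜ s)
    (hqs : connectedComponentIn Kᶜ q ≠ connectedComponentIn Kᶜ s) {k l : ℤ}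
    (h : HasLogOn (fun z => ((z - p) / (z - s)) ^ k * ((z - q) / (z - s)) ^ l) K) :
    k = 0 ∧ l = 0 := by
  have exponents_eq_zero : ![k, l, -k - l] = 0 := by
    refine eq_zero_of_hasLogOn_prod_zpow hK (p := ![p, q, s])
      (by simp [Fin.forall_fin_succ, hp, hq, hs])
      (by simp [Function.Injective, Fin.forall_fin_succ, hpq, hps, hqs, hpq.symm, hps.symm,
        hqs.symm]) (by simp [Fin.sum_univ_succ]) (h.congr fun z hz => ?_)
    have hzs : z - s ≠ 0 := sub_ne_zero.2 fun hzs => hs (hzs ▸ hz)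
    simp only [Fin.prod_univ_three, Matrix.cons_val, div_zpow, zpow_sub₀ hzs, zpow_neg]
    ring
  exact ⟨congrFun exponents_eq_zero 0, congrFun exponents_eq_zero 1⟩

lemma encard_image_connectedComponentIn_sdiff_range_le {K : Set ℂ} (hK : IsCompact K)
    {α : C(unitInterval, ℂ)} (hα : Function.Injective α) (hKα : K ∩ range α = {α 0, α 1}) (x : ℂ) :
    (connectedComponentIn (K ∪ range α)ᶜ '' (connectedComponentIn Kᶜ x \ range α)).encard ≤ 2 := by
  have hA : IsCompact (range α) := isCompact_range α.continuous
  by_contra! two_lt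
  obtain ⟨T, T_subset, hT⟩ := exists_subset_encard_eq (Order.add_one_le_of_lt two_lt)
  obtain ⟨_, _, _, hpq, hps, hqs, rfl⟩ := encard_eq_three.1 hT
  rw [insert_subset_iff, insert_subset_iff, singleton_subset_iff] at T_subset
  obtain ⟨⟨p, hp, rfl⟩, ⟨q, hq, rfl⟩, ⟨s, hs, rfl⟩⟩ := T_subset
  have notMem_K {z : ℂ} (hz : z ∈ connectedComponentIn Kᶜ x \ range α) : z ∉ K :=
    connectedComponentIn_subset _ _ hz.1
  have log_K {z : ℂ} (hz : z ∈ connectedComponentIn Kᶜ x \ range α) :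
      HasLogOn (fun w => (w - z) / (w - s)) K :=
    (hasLogOn_sub_div_sub_iff hK (notMem_K hz) (notMem_K hs)).2 <|
      (connectedComponentIn_eq hz.1).symm.trans (connectedComponentIn_eq hs.1)
  have log_range {z : ℂ} (hz : z ∈ connectedComponentIn Kᶜ x \ range α) :
      HasLogOn (fun w => (w - z) / (w - s)) (range α) := by
    have sub_ne_zero_of_mem {y : ℂ} (hy : y ∉ range α) : ∀ w ∈ range α, w - y ≠ 0 :=
      fun w hw hwy => hy (sub_eq_zero.1 hwy ▸ hw)
    exact hasLogOn_range_of_injective hα (.div (by fun_prop) (by fun_prop)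
      (sub_ne_zero_of_mem hs.2)) fun w hw =>
        div_ne_zero (sub_ne_zero_of_mem hz.2 w hw) (sub_ne_zero_of_mem hs.2 w hw)
  obtain ⟨k, l, hkl, log_union⟩ := HasLogOn.exists_zpow_mul_zpow_union hK.isClosed hA.isClosed hKα
    (log_K hp) (log_range hp) (log_K hq) (log_range hq)
  have exponents_eq_zero := eq_zero_of_hasLogOn_zpow_mul_zpow (hK.union hA)
    (not_or.2 ⟨notMem_K hp, hp.2⟩) (not_or.2 ⟨notMem_K hq, hq.2⟩) (not_or.2 ⟨notMem_K hs, hs.2⟩)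
    hpq hps hqs log_union
  exact hkl.elim (· exponents_eq_zero.1) (· exponents_eq_zero.2)

end PlaneSeparation

section Subgraph

open SimpleGraph

variable {V : Type*} {G : SimpleGraph V}

lemma deleteEdges_singleton_sup_subgraphOfAdj {S : G.Subgraph} {u v : V} (h : S.Adj u v) :
    S.deleteEdges {s(u, v)} ⊔ G.subgraphOfAdj (S.adj_sub h) = S := by
  ext x y
  · grind [Subgraph.verts_sup, Subgraph.deleteEdges_verts, subgraphOfAdj_verts, S.edge_vert h,
      S.edge_vert h.symm]
  · grind [Subgraph.sup_adj, Subgraph.deleteEdges_adj, subgraphOfAdj_adj, S.adj_symm]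

lemma natCard_edgeSet_coe (S : G.Subgraph) : Nat.card S.coe.edgeSet = S.edgeSet.ncard := by
  rw [← S.image_coe_edgeSet_coe,
    Set.ncard_image_of_injective _ (Sym2.map.injective Subtype.val_injective),
    Nat.card_coe_set_eq]

lemma girth_le_natCard_edgeSet [Finite V] (G : SimpleGraph V) : G.girth ≤ Nat.card G.edgeSet := by
  by_cases acyclic : G.IsAcyclic
  · simp [acyclic.girth_eq_zero]
  · obtain ⟨v, c, isCycle, girth_eq⟩ := exists_girth_eq_length.2 acyclic
    classical
    rw [girth_eq, Nat.card_coe_set_eq, ← c.length_edges,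
      ← List.toFinset_card_of_nodup isCycle.edges_nodup, ← Set.ncard_coe_finset]
    exact Set.ncard_le_ncard fun e he => c.edges_subset_edgeSet (List.mem_toFinset.1 he)

lemma four_le_girth_of_cliqueFree_three (hG : G.CliqueFree 3) (hG' : ¬ G.IsAcyclic) :
    4 ≤ G.girth := by
  refine (three_le_girth hG').lt_of_ne' fun girth_eq => ?_
  obtain ⟨u, w, isCycle, length_eq⟩ := exists_girth_eq_length.2 hG'
  obtain ⟨s, hs⟩ := is3Clique_iff_exists_cycle_length_three.2
    ⟨u, w, isCycle, length_eq.symm.trans girth_eq⟩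
  exact hG s hs

lemma exists_subsingleton_neighborSet_of_isAcyclic [Finite V] [Nonempty V] (hG : G.IsAcyclic) :
    ∃ v, (G.neighborSet v).Subsingleton := by
  obtain ⟨u, v, p, hp, longest⟩ := Walk.exists_isPath_forall_isPath_length_le_length G
  have eq_penultimate (w : V) (hvw : G.Adj v w) : w = p.penultimate := by
    refine hG.eq_penultimate_of_adj_end hp hvw ?_
    by_contra hw
    have := longest _ _ _ (hp.concat hw hvw)
    simp at this
  exact ⟨v, fun x hx y hy => (eq_penultimate x hx).trans (eq_penultimate y hy).symm⟩

lemma exists_eq_deleteVerts_singleton_sup_of_isAcyclic [Finite V]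
    {S : G.Subgraph} (hS : S.coe.IsAcyclic) (nonempty : S.verts.Nonempty) :
    ∃ v ∈ S.verts, S = S.deleteVerts {v} ⊔ G.singletonSubgraph v ∨
      ∃ u, ∃ h : S.Adj u v, S = S.deleteVerts {v} ⊔ G.subgraphOfAdj (S.adj_sub h) := by
  have := nonempty.to_subtype
  obtain ⟨⟨v, hv⟩, unique_neighbor⟩ := exists_subsingleton_neighborSet_of_isAcyclic hS
  refine ⟨v, hv, ?_⟩
  by_cases isolated : ∀ u, ¬ S.Adj u v
  · left
    ext x y
    · grind [Subgraph.verts_sup, Subgraph.deleteVerts_verts, singletonSubgraph_verts]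
    · simp only [Subgraph.sup_adj, Subgraph.deleteVerts_adj, singletonSubgraph_adj, Pi.bot_apply,
        Prop.bot_eq_false, or_false]
      grind [S.edge_vert, S.adj_symm]
  · push Not at isolated
    obtain ⟨u, huv⟩ := isolated
    have eq_u (x : V) (hx : S.Adj x v) : x = u := congrArg Subtype.val
      (unique_neighbor (x := ⟨x, S.edge_vert hx⟩) hx.symm (y := ⟨u, S.edge_vert huv⟩) huv.symm)
    refine Or.inr ⟨u, huv, ?_⟩
    ext x y
    · grind [Subgraph.verts_sup, Subgraph.deleteVerts_verts, subgraphOfAdj_verts, S.edge_vert huv]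
    · grind [Subgraph.sup_adj, Subgraph.deleteVerts_adj, subgraphOfAdj_adj, S.edge_vert,
        S.adj_symm]

end Subgraph

namespace SimpleGraph.PlaneDrawing

open Set

variable {V : Type*} {G : SimpleGraph V} (D : G.PlaneDrawing)

/-- The point representing a vertex, in the plane identified with `ℂ`. -/
noncomputable def pt (v : V) : ℂ := Complex.orthonormalBasisOneI.repr.symm (D.point v)

/-- The arc representing an edge, in the plane identified with `ℂ`. -/
noncomputable def curve (e : G.edgeSet) : C(unitInterval, ℂ) :=
  ⟨fun t => Complex.orthonormalBasisOneI.repr.symm (D.arc e t), by fun_prop⟩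

/-- The part of the plane covered by the vertices and edges of a subgraph. Only the interiors of
the arcs are listed, which makes the union disjoint; the ends of the arcs are vertices. -/
def carrier (S : G.Subgraph) : Set ℂ :=
  D.pt '' S.verts ∪ ⋃ e ∈ {e : G.edgeSet | e.1 ∈ S.edgeSet}, D.curve e '' Ioo 0 1

lemma pt_injective : Function.Injective D.pt :=
  Complex.orthonormalBasisOneI.repr.symm.injective.comp D.point_injective

lemma curve_injective (e : G.edgeSet) : Function.Injective (D.curve e) :=
  Complex.orthonormalBasisOneI.repr.symm.injective.comp (D.arc_injective e)

lemma curve_ne_pt (e : G.edgeSet) {t : unitInterval} (ht : t ∈ Ioo 0 1) (v : V) :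
    D.curve e t ≠ D.pt v :=
  Complex.orthonormalBasisOneI.repr.symm.injective.ne (D.arc_ne_point e t ht v)

lemma eq_of_curve_eq_curve {e f : G.edgeSet} {s t : unitInterval} (hs : s ∈ Ioo 0 1)
    (ht : t ∈ Ioo 0 1) (h : D.curve e s = D.curve f t) : e = f := by
  by_contra hef
  exact D.arc_ne_arc e f hef s hs t ht (Complex.orthonormalBasisOneI.repr.symm.injective h)

lemma sym2_curve_ends (e : G.edgeSet) : s(D.curve e 0, D.curve e 1) = e.1.map D.pt :=
  (congrArg (Sym2.map Complex.orthonormalBasisOneI.repr.symm) (D.arc_ends e)).trans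
    (Sym2.map_map ..)

lemma joinedIn_range_curve {u v : V} (h : G.Adj u v) :
    JoinedIn (range (D.curve ⟨s(u, v), h⟩)) (D.pt u) (D.pt v) := by
  have joined_ends : JoinedIn (range (D.curve ⟨s(u, v), h⟩)) (D.curve ⟨s(u, v), h⟩ 0)
      (D.curve ⟨s(u, v), h⟩ 1) := ⟨⟨D.curve _, rfl, rfl⟩, mem_range_self⟩
  rcases Sym2.eq_iff.1 (D.sym2_curve_ends ⟨s(u, v), h⟩) with ⟨h0, h1⟩ | ⟨h0, h1⟩
  · rwa [h0, h1] at joined_ends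
  · rw [h0, h1] at joined_ends
    exact joined_ends.symm

lemma pair_curve_ends {u v : V} (h : G.Adj u v) :
    ({D.curve ⟨s(u, v), h⟩ 0, D.curve ⟨s(u, v), h⟩ 1} : Set ℂ) = {D.pt u, D.pt v} := by
  rcases Sym2.eq_iff.1 (D.sym2_curve_ends ⟨s(u, v), h⟩) with ⟨h0, h1⟩ | ⟨h0, h1⟩
  · rw [h0, h1]
  · rw [h0, h1, pair_comm]

lemma range_curve {u v : V} (h : G.Adj u v) :
    range (D.curve ⟨s(u, v), h⟩) =
      {D.pt u, D.pt v} ∪ D.curve ⟨s(u, v), h⟩ '' Ioo 0 1 := by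
  have univ_eq : (univ : Set unitInterval) = {0, 1} ∪ Ioo 0 1 := by
    rw [union_comm, Ioo_union_both zero_le_one]
    exact (Icc_bot_top).symm
  rw [← image_univ, univ_eq, image_union, image_pair, D.pair_curve_ends h]

lemma pt_mem_carrier_iff {S : G.Subgraph} {v : V} : D.pt v ∈ D.carrier S ↔ v ∈ S.verts := by
  refine ⟨fun h => ?_, fun h => Or.inl (mem_image_of_mem _ h)⟩
  rcases h with ⟨w, hw, hwv⟩ | h
  · exact D.pt_injective hwv ▸ hw
  · obtain ⟨e, -, t, ht, hev⟩ := mem_iUnion₂.1 h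
    exact absurd hev (D.curve_ne_pt e ht v)

lemma curve_mem_carrier_iff {S : G.Subgraph} {e : G.edgeSet} {t : unitInterval}
    (ht : t ∈ Ioo 0 1) : D.curve e t ∈ D.carrier S ↔ e.1 ∈ S.edgeSet := by
  refine ⟨fun h => ?_, fun h => Or.inr (mem_biUnion h (mem_image_of_mem _ ht))⟩
  rcases h with ⟨v, -, hv⟩ | h
  · exact absurd hv.symm (D.curve_ne_pt e ht v)
  · obtain ⟨f, hf, s, hs, hfe⟩ := mem_iUnion₂.1 h
    exact D.eq_of_curve_eq_curve hs ht hfe ▸ hf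

@[gcongr]
lemma carrier_mono {S T : G.Subgraph} (h : S ≤ T) : D.carrier S ⊆ D.carrier T :=
  union_subset_union (image_mono h.1)
    (biUnion_subset_biUnion_left fun _ he => Subgraph.edgeSet_mono h he)

lemma carrier_sup (S T : G.Subgraph) : D.carrier (S ⊔ T) = D.carrier S ∪ D.carrier T := by
  have edges_eq : {e : G.edgeSet | e.1 ∈ (S ⊔ T).edgeSet} =
      {e : G.edgeSet | e.1 ∈ S.edgeSet} ∪ {e : G.edgeSet | e.1 ∈ T.edgeSet} := by
    ext e
    simp
  rw [carrier, edges_eq, biUnion_union, Subgraph.verts_sup, image_union]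
  exact union_union_union_comm ..

lemma carrier_inf (S T : G.Subgraph) : D.carrier (S ⊓ T) = D.carrier S ∩ D.carrier T := by
  refine Subset.antisymm (subset_inter (D.carrier_mono inf_le_left)
    (D.carrier_mono inf_le_right)) ?_
  rintro _ ⟨⟨v, hv, rfl⟩ | h, hT⟩
  · exact D.pt_mem_carrier_iff.2 ⟨hv, D.pt_mem_carrier_iff.1 hT⟩
  · obtain ⟨e, he, t, ht, rfl⟩ := mem_iUnion₂.1 h
    rw [D.curve_mem_carrier_iff ht, Subgraph.edgeSet_inf]
    exact ⟨he, (D.curve_mem_carrier_iff ht).1 hT⟩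

lemma carrier_subgraphOfAdj {u v : V} (h : G.Adj u v) :
    D.carrier (G.subgraphOfAdj h) = range (D.curve ⟨s(u, v), h⟩) := by
  have edges_eq : {e : G.edgeSet | e.1 ∈ (G.subgraphOfAdj h).edgeSet} = {⟨s(u, v), h⟩} := by
    ext e
    simp [Subtype.ext_iff]
  rw [carrier, edges_eq, biUnion_singleton, D.range_curve h, subgraphOfAdj_verts, image_pair]

lemma range_curve_subset_carrier {S : G.Subgraph} {e : G.edgeSet} (he : e.1 ∈ S.edgeSet) :
    range (D.curve e) ⊆ D.carrier S := by
  obtain ⟨⟨u, v⟩, h⟩ := e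
  rw [← D.carrier_subgraphOfAdj h]
  exact D.carrier_mono (subgraphOfAdj_le_of_adj S he)

lemma isCompact_carrier [Finite V] (S : G.Subgraph) : IsCompact (D.carrier S) := by
  have carrier_eq : D.carrier S =
      D.pt '' S.verts ∪ ⋃ e ∈ {e : G.edgeSet | e.1 ∈ S.edgeSet}, range (D.curve e) :=
    Subset.antisymm (union_subset_union_right _ (iUnion₂_mono fun e _ => image_subset_range _ _))
      (union_subset subset_union_left (iUnion₂_subset fun e => D.range_curve_subset_carrier))
  rw [carrier_eq]
  exact ((toFinite S.verts).image _).isCompact.union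
    ((toFinite _).isCompact_biUnion fun e _ => isCompact_range (D.curve e).continuous)

lemma joinedIn_carrier_of_reachable {S : G.Subgraph} {u v : V} (hu : u ∈ S.verts)
    (huv : S.spanningCoe.Reachable u v) : JoinedIn (D.carrier S) (D.pt u) (D.pt v) := by
  obtain ⟨w⟩ := huv
  induction w with
  | nil => exact JoinedIn.refl (D.pt_mem_carrier_iff.2 hu)
  | cons huv _ ih =>
    exact ((D.joinedIn_range_curve (S.adj_sub huv)).mono (D.range_curve_subset_carrier huv)).trans
      (ih (S.edge_vert huv.symm))

lemma subsingleton_carrier {S : G.Subgraph} (hS : S.verts.Subsingleton) :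
    (D.carrier S).Subsingleton := by
  have no_edges : {e : G.edgeSet | e.1 ∈ S.edgeSet} = ∅ := by
    refine eq_empty_of_forall_notMem ?_
    rintro ⟨⟨u, v⟩, h⟩ he
    exact h.ne (hS (S.edge_vert he) (S.edge_vert (S.adj_symm he)))
  rw [carrier, no_edges, biUnion_empty, union_empty]
  exact hS.image _

lemma hasLogOn_carrier_sup [Finite V] {S T : G.Subgraph} (hST : (S.verts ∩ T.verts).Subsingleton)
    {f : ℂ → ℂ} (hS : HasLogOn f (D.carrier S)) (hT : HasLogOn f (D.carrier T)) :
    HasLogOn f (D.carrier (S ⊔ T)) := by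
  rw [D.carrier_sup]
  refine HasLogOn.union_of_isClosed (D.isCompact_carrier S).isClosed
    (D.isCompact_carrier T).isClosed ?_ hS hT
  rw [← D.carrier_inf]
  exact (D.subsingleton_carrier (S := S ⊓ T) hST).isPreconnected

lemma hasLogOn_carrier_subgraphOfAdj {u v : V} (h : G.Adj u v) {f : ℂ → ℂ}
    (hf : ContinuousOn f (D.carrier (G.subgraphOfAdj h)))
    (f_ne_zero : ∀ z ∈ D.carrier (G.subgraphOfAdj h), f z ≠ 0) :
    HasLogOn f (D.carrier (G.subgraphOfAdj h)) := by
  rw [D.carrier_subgraphOfAdj] at hf f_ne_zero ⊢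
  exact hasLogOn_range_of_injective (D.curve_injective _) hf f_ne_zero

/-- A forest is built up by attaching one leaf or one isolated vertex at a time, and logarithms on
two closed sets meeting in at most one point can be glued. -/
theorem hasLogOn_carrier_of_isAcyclic [Finite V] {S : G.Subgraph} (hS : S.coe.IsAcyclic)
    {f : ℂ → ℂ} (hf : ContinuousOn f (D.carrier S)) (f_ne_zero : ∀ z ∈ D.carrier S, f z ≠ 0) :
    HasLogOn f (D.carrier S) := by
  induction S using WellFoundedLT.induction with
  | ind S ih =>
    rcases S.verts.eq_empty_or_nonempty with empty | nonempty
    · exact hasLogOn_of_subsingleton (D.subsingleton_carrier (by simp [empty])) f_ne_zero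
    obtain ⟨v, hv, decomposition⟩ :=
      exists_eq_deleteVerts_singleton_sup_of_isAcyclic hS nonempty
    have le_S : S.deleteVerts {v} ≤ S := Subgraph.deleteVerts_le
    have lt_S : S.deleteVerts {v} < S := le_S.lt_of_not_ge fun h => (h.1 hv).2 rfl
    have log_rest : HasLogOn f (D.carrier (S.deleteVerts {v})) :=
      ih _ lt_S (hS.comap _ (Subgraph.inclusion.injective le_S)) (hf.mono (D.carrier_mono le_S))
        fun z hz => f_ne_zero z (D.carrier_mono le_S hz)
    rcases decomposition with eq_sup | ⟨u, huv, eq_sup⟩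
    · rw [eq_sup]
      refine D.hasLogOn_carrier_sup (by simp) log_rest (hasLogOn_of_subsingleton
        (D.subsingleton_carrier subsingleton_singleton) fun z hz => f_ne_zero z ?_)
      exact D.carrier_mono ((singletonSubgraph_le_iff v S).2 hv) hz
    · have edge_le : G.subgraphOfAdj (S.adj_sub huv) ≤ S := subgraphOfAdj_le_of_adj S huv
      rw [eq_sup]
      refine D.hasLogOn_carrier_sup (subsingleton_singleton.anti (t := {u}) ?_) log_rest
        (D.hasLogOn_carrier_subgraphOfAdj _ (hf.mono (D.carrier_mono edge_le))
          fun z hz => f_ne_zero z (D.carrier_mono edge_le hz))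
      rintro x ⟨⟨-, hxv⟩, hx⟩
      exact hx.resolve_right hxv

theorem connectedComponentIn_compl_carrier_eq_of_isAcyclic [Finite V] {S : G.Subgraph}
    (hS : S.coe.IsAcyclic) {p q : ℂ} (hp : p ∉ D.carrier S) (hq : q ∉ D.carrier S) :
    connectedComponentIn (D.carrier S)ᶜ p = connectedComponentIn (D.carrier S)ᶜ q := by
  have sub_ne_zero {w : ℂ} (hw : w ∉ D.carrier S) : ∀ z ∈ D.carrier S, z - w ≠ 0 :=
    fun z hz => sub_ne_zero.2 (ne_of_mem_of_not_mem hz hw)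
  refine (hasLogOn_sub_div_sub_iff (D.isCompact_carrier S) hp hq).1
    (D.hasLogOn_carrier_of_isAcyclic hS ?_ fun z hz =>
      div_ne_zero (sub_ne_zero hp z hz) (sub_ne_zero hq z hz))
  exact ContinuousOn.div (by fun_prop) (by fun_prop) (sub_ne_zero hq)

lemma le_of_carrier_subset {S T : G.Subgraph} (h : D.carrier S ⊆ D.carrier T) : S ≤ T := by
  obtain ⟨t, ht⟩ := exists_between (zero_lt_one' unitInterval)
  exact ⟨fun v hv => D.pt_mem_carrier_iff.1 (h (D.pt_mem_carrier_iff.2 hv)), fun u v huv =>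
    (D.curve_mem_carrier_iff (e := ⟨s(u, v), S.adj_sub huv⟩) ht).1
      (h ((D.curve_mem_carrier_iff ht).2 huv))⟩

/-- The boundary of a face `F` of the drawing, as a spanning subgraph: it consists of the edges
whose arcs have an interior point in the closure of `F`. -/
def boundary (F : Set ℂ) : G.Subgraph where
  verts := univ
  Adj u v := ∃ h : G.Adj u v, ∃ t ∈ Ioo 0 1, D.curve ⟨s(u, v), h⟩ t ∈ closure F
  adj_sub h := h.1
  edge_vert _ := mem_univ _
  symm := ⟨fun u v ⟨h, t, ht, hF⟩ => ⟨h.symm, t, ht, by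
    have swap : (⟨s(v, u), h.symm⟩ : G.edgeSet) = ⟨s(u, v), h⟩ := Subtype.ext Sym2.eq_swap
    rwa [swap]⟩⟩

lemma mem_edgeSet_boundary {F : Set ℂ} {e : G.edgeSet} :
    e.1 ∈ (D.boundary F).edgeSet ↔ ∃ t ∈ Ioo 0 1, D.curve e t ∈ closure F := by
  obtain ⟨⟨u, v⟩, h⟩ := e
  exact exists_prop_of_true h

lemma carrier_inter_closure_subset (F : Set ℂ) (S : G.Subgraph) :
    D.carrier S ∩ closure F ⊆ D.carrier (D.boundary F) := by
  rintro _ ⟨⟨v, -, rfl⟩ | h, hF⟩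
  · exact D.pt_mem_carrier_iff.2 (mem_univ v)
  · obtain ⟨e, -, t, ht, rfl⟩ := mem_iUnion₂.1 h
    exact (D.curve_mem_carrier_iff ht).2 (D.mem_edgeSet_boundary.2 ⟨t, ht, hF⟩)

lemma compl_carrier_boundary_subset_of_isAcyclic [Finite V] {F : Set ℂ}
    (hF : F ∈ complementComponents (D.carrier ⊤)) (acyclic : (D.boundary F).coe.IsAcyclic) :
    (D.carrier (D.boundary F))ᶜ ⊆ F := by
  obtain ⟨p, hp, rfl⟩ := hF
  set F := connectedComponentIn (D.carrier ⊤)ᶜ p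
  have closed := (D.isCompact_carrier (⊤ : G.Subgraph)).isClosed
  have isOpen_F : IsOpen F := closed.isOpen_compl.connectedComponentIn
  have hp' : p ∉ D.carrier (D.boundary F) := fun h => hp (D.carrier_mono le_top h)
  intro q hq
  suffices connectedComponentIn (D.carrier (D.boundary F))ᶜ p ⊆ F by
    apply this
    rw [D.connectedComponentIn_compl_carrier_eq_of_isAcyclic acyclic hp' hq]
    exact mem_connectedComponentIn hq
  refine isPreconnected_connectedComponentIn.subset_of_closure_inter_subset isOpen_F
    ⟨p, mem_connectedComponentIn hp', mem_connectedComponentIn hp⟩ ?_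
  rintro z ⟨z_mem_closure, hz⟩
  by_contra hzF
  have z_mem_frontier : z ∈ frontier F := ⟨z_mem_closure, isOpen_F.interior_eq.symm ▸ hzF⟩
  have z_mem_carrier := frontier_connectedComponentIn_compl_subset closed p z_mem_frontier
  exact connectedComponentIn_subset _ _ hz
    (D.carrier_inter_closure_subset F ⊤ ⟨z_mem_carrier, z_mem_closure⟩)

theorem not_isAcyclic_boundary [Finite V] (hG : ¬ G.IsAcyclic) {F : Set ℂ}
    (hF : F ∈ complementComponents (D.carrier ⊤)) : ¬ (D.boundary F).coe.IsAcyclic := by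
  intro acyclic
  have F_subset : F ⊆ (D.carrier ⊤)ᶜ := by
    obtain ⟨p, -, rfl⟩ := hF
    exact connectedComponentIn_subset _ _
  have boundary_eq_top : D.boundary F = ⊤ := top_le_iff.1 <| D.le_of_carrier_subset <|
    compl_subset_compl.1 <| (D.compl_carrier_boundary_subset_of_isAcyclic hF acyclic).trans F_subset
  rw [boundary_eq_top, Subgraph.topIso.isAcyclic_iff] at acyclic
  exact hG acyclic

lemma image_Ioo_subset_connectedComponentIn {S : G.Subgraph} {e : G.edgeSet}
    (he : e.1 ∉ S.edgeSet) {t : unitInterval} (ht : t ∈ Ioo 0 1) :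
    D.curve e '' Ioo 0 1 ⊆ connectedComponentIn (D.carrier S)ᶜ (D.curve e t) := by
  refine (isPreconnected_Ioo.image _ (by fun_prop)).subset_connectedComponentIn
    (mem_image_of_mem _ ht) ?_
  rintro _ ⟨s, hs, rfl⟩
  exact (D.curve_mem_carrier_iff hs).not.2 he

lemma carrier_inter_range_curve {S : G.Subgraph} {u v : V} (h : G.Adj u v) (hu : u ∈ S.verts)
    (hv : v ∈ S.verts) (not_adj : ¬ S.Adj u v) :
    D.carrier S ∩ range (D.curve ⟨s(u, v), h⟩) = {D.pt u, D.pt v} := by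
  have disjoint_interior : D.carrier S ∩ D.curve ⟨s(u, v), h⟩ '' Ioo 0 1 = ∅ := by
    refine disjoint_iff_inter_eq_empty.1 (disjoint_right.2 ?_)
    rintro _ ⟨t, ht, rfl⟩
    exact (D.curve_mem_carrier_iff ht).not.2 not_adj
  rw [D.range_curve h, inter_union_distrib_left, disjoint_interior, union_empty, inter_eq_right]
  exact pair_subset (D.pt_mem_carrier_iff.2 hu) (D.pt_mem_carrier_iff.2 hv)

theorem encard_setOf_mem_edgeSet_boundary_le_two [Finite V] (e : G.edgeSet) :
    {F ∈ complementComponents (D.carrier ⊤) | e.1 ∈ (D.boundary F).edgeSet}.encard ≤ 2 := by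
  obtain ⟨⟨u, v⟩, h⟩ := e
  set e : G.edgeSet := ⟨s(u, v), h⟩
  set S : G.Subgraph := (⊤ : G.Subgraph).deleteEdges {s(u, v)}
  have not_adj : ¬ S.Adj u v := by simp [S]
  have carrier_top : D.carrier ⊤ = D.carrier S ∪ range (D.curve e) := by
    have top_eq := deleteEdges_singleton_sup_subgraphOfAdj (S := (⊤ : G.Subgraph)) h
    rw [← D.carrier_subgraphOfAdj h, ← D.carrier_sup, top_eq]
  obtain ⟨t₀, ht₀⟩ := exists_between (zero_lt_one' unitInterval)
  have inter_eq := D.carrier_inter_range_curve (S := S) h (mem_univ _) (mem_univ _) not_adj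
  rw [← D.pair_curve_ends h] at inter_eq
  refine (encard_le_encard ?_).trans (encard_image_connectedComponentIn_sdiff_range_le
    (D.isCompact_carrier S) (D.curve_injective e) inter_eq (D.curve e t₀))
  rintro _ ⟨⟨p, -, rfl⟩, he⟩
  obtain ⟨t, ht, mem_closure⟩ := D.mem_edgeSet_boundary.1 he
  obtain ⟨y, y_mem_component, y_mem_face⟩ := mem_closure_iff.1 mem_closure
    (connectedComponentIn (D.carrier S)ᶜ (D.curve e t₀))
    (D.isCompact_carrier S).isClosed.isOpen_compl.connectedComponentIn
    (D.image_Ioo_subset_connectedComponentIn (S := S) (e := e) not_adj ht₀ (mem_image_of_mem _ ht))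
  have hy : y ∉ D.carrier ⊤ := connectedComponentIn_subset _ _ y_mem_face
  rw [connectedComponentIn_eq y_mem_face, ← carrier_top]
  exact mem_image_of_mem _ ⟨y_mem_component, fun hr => hy (carrier_top ▸ Or.inr hr)⟩

lemma encard_complementComponents_carrier_add_one_le [Finite V] {S : G.Subgraph} {u v : V}
    (h : G.Adj u v) (hu : u ∈ S.verts) (reachable : S.spanningCoe.Reachable u v)
    (not_adj : ¬ S.Adj u v) :
    (complementComponents (D.carrier S)).encard + 1 ≤
      (complementComponents (D.carrier (S ⊔ G.subgraphOfAdj h))).encard := by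
  obtain ⟨t, ht⟩ := exists_between (zero_lt_one' unitInterval)
  rw [D.carrier_sup, D.carrier_subgraphOfAdj h]
  refine encard_complementComponents_add_one_le_of_joinedIn (D.isCompact_carrier S).isClosed
    (isCompact_range (D.curve _).continuous).isClosed (D.pt_injective.ne h.ne)
    (D.joinedIn_carrier_of_reachable hu reachable) (D.joinedIn_range_curve h)
    (x := D.curve ⟨s(u, v), h⟩ t) ?_
  rw [D.range_curve h, sdiff_subset_iff]
  exact union_subset_union_right _
    (D.image_Ioo_subset_connectedComponentIn (e := ⟨s(u, v), h⟩) not_adj ht)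

lemma one_le_encard_complementComponents_carrier [Finite V] (S : G.Subgraph) :
    1 ≤ (complementComponents (D.carrier S)).encard := by
  obtain ⟨p, hp⟩ := (ne_univ_iff_exists_notMem _).1 (D.isCompact_carrier S).ne_univ
  exact one_le_encard_iff_nonempty.2 ⟨_, mem_complementComponents hp⟩

/-- Euler's inequality: delete edges that are not bridges, one at a time, until a tree remains. -/
theorem ncard_edgeSet_add_two_le [Finite V] {S : G.Subgraph} (hS : S.spanningCoe.Connected) :
    (S.edgeSet.ncard : ℕ∞) + 2 ≤ (complementComponents (D.carrier S)).encard + Nat.card V := by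
  induction S using WellFoundedLT.induction with
  | ind S ih =>
    by_cases acyclic : S.spanningCoe.IsAcyclic
    · have card_eq := (isTree_iff_connected_and_card.1 ⟨hS, acyclic⟩).2
      have one_le := D.one_le_encard_complementComponents_carrier S
      rw [Nat.card_coe_set_eq, Subgraph.edgeSet_spanningCoe] at card_eq
      calc (S.edgeSet.ncard : ℕ∞) + 2 = 1 + (S.edgeSet.ncard + 1 : ℕ) := by push_cast; ring
        _ ≤ (complementComponents (D.carrier S)).encard + Nat.card V := by
          rw [card_eq]
          exact add_le_add one_le le_rfl
    · simp only [isAcyclic_iff_forall_isBridge] at acyclic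
      push Not at acyclic
      obtain ⟨⟨u, v⟩, huv : S.Adj u v, not_isBridge⟩ := acyclic
      set S₀ := S.deleteEdges {s(u, v)}
      have spanningCoe_eq : S.spanningCoe.deleteEdges {s(u, v)} = S₀.spanningCoe :=
        S.deleteEdges_spanningCoe_eq _
      have connected : S₀.spanningCoe.Connected :=
        spanningCoe_eq ▸ hS.connected_delete_edge_of_not_isBridge not_isBridge
      have not_adj : ¬ S₀.Adj u v := by simp [S₀]
      have lt : S₀ < S := (S.deleteEdges_le _).lt_of_not_ge fun h => not_adj (h.2 huv)
      have ncard_eq : S₀.edgeSet.ncard + 1 = S.edgeSet.ncard := by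
        rw [← S₀.edgeSet_spanningCoe, ← spanningCoe_eq, edgeSet_deleteEdges,
          S.edgeSet_spanningCoe]
        exact ncard_sdiff_singleton_add_one huv
      have faces := D.encard_complementComponents_carrier_add_one_le (S.adj_sub huv)
        (S := S₀) (S.edge_vert huv) (connected u v) not_adj
      rw [deleteEdges_singleton_sup_subgraphOfAdj huv] at faces
      calc (S.edgeSet.ncard : ℕ∞) + 2 = S₀.edgeSet.ncard + 2 + 1 := by
            rw [← ncard_eq]; push_cast; ring
        _ ≤ (complementComponents (D.carrier S₀)).encard + Nat.card V + 1 :=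
            add_le_add (ih S₀ lt connected) le_rfl
        _ = (complementComponents (D.carrier S₀)).encard + 1 + Nat.card V := add_right_comm ..
        _ ≤ (complementComponents (D.carrier S)).encard + Nat.card V := add_le_add faces le_rfl

end SimpleGraph.PlaneDrawing

namespace SimpleGraph.PlaneDrawing

open Finset

variable {V : Type*} [Finite V] {G : SimpleGraph V} (D : G.PlaneDrawing)

lemma girth_le_ncard_edgeSet_boundary {F : Set ℂ}
    (hF : F ∈ complementComponents (D.carrier ⊤)) :
    G.girth ≤ (D.boundary F).edgeSet.ncard := by
  by_cases hG : G.IsAcyclic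
  · simp [hG.girth_eq_zero]
  · calc G.girth ≤ (D.boundary F).coe.girth :=
          (D.boundary F).coe_isContained.girth_le (D.not_isAcyclic_boundary hG hF)
      _ ≤ Nat.card (D.boundary F).coe.edgeSet := girth_le_natCard_edgeSet _
      _ = (D.boundary F).edgeSet.ncard := natCard_edgeSet_coe _

lemma card_mul_girth_le {𝓕 : Finset (Set ℂ)}
    (h𝓕 : (𝓕 : Set (Set ℂ)) ⊆ complementComponents (D.carrier ⊤)) :
    #𝓕 * G.girth ≤ Nat.card G.edgeSet * 2 := by
  classical
  have finite_edgeSet := G.edgeSet.toFinite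
  rw [Nat.card_coe_set_eq, Set.ncard_eq_toFinset_card _ finite_edgeSet]
  refine card_mul_le_card_mul (fun F e => e ∈ (D.boundary F).edgeSet) (fun F hF => ?_)
    fun e he => ?_
  · refine (D.girth_le_ncard_edgeSet_boundary (h𝓕 hF)).trans ?_
    rw [← Set.ncard_coe_finset]
    refine Set.ncard_le_ncard fun e he => ?_
    simpa [bipartiteAbove] using ⟨(D.boundary F).edgeSet_subset he, he⟩
  · rw [← Nat.cast_le (α := ℕ∞), ← Set.encard_coe_eq_coe_finsetCard]
    refine (Set.encard_le_encard fun F hF => ?_).trans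
      (D.encard_setOf_mem_edgeSet_boundary_le_two ⟨e, finite_edgeSet.mem_toFinset.1 he⟩)
    obtain ⟨hF, he⟩ := mem_filter.1 hF
    exact ⟨h𝓕 hF, he⟩

end SimpleGraph.PlaneDrawing

theorem SimpleGraph.IsPlanar.girth_mul_le {V : Type*} [Finite V] {G : SimpleGraph V}
    (hG : G.IsPlanar) (connected : G.Connected) :
    G.girth * (Nat.card G.edgeSet + 2) ≤ 2 * Nat.card G.edgeSet + G.girth * Nat.card V := by
  obtain ⟨D⟩ := hG
  have euler := D.ncard_edgeSet_add_two_le (S := ⊤) (by simpa using connected)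
  rw [Subgraph.edgeSet_top, ← Nat.card_coe_set_eq, ← tsub_le_iff_right] at euler
  obtain ⟨𝓕, h𝓕, card_eq⟩ := Set.exists_subset_encard_eq
    (k := (Nat.card G.edgeSet + 2 - Nat.card V : ℕ)) (by push_cast; exact euler)
  lift 𝓕 to Finset (Set ℂ) using Set.finite_of_encard_eq_coe card_eq
  rw [Set.encard_coe_eq_coe_finsetCard, Nat.cast_inj] at card_eq
  have count := D.card_mul_girth_le h𝓕
  calc G.girth * (Nat.card G.edgeSet + 2) ≤ G.girth * (𝓕.card + Nat.card V) := by
        exact Nat.mul_le_mul_left _ (by omega)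
    _ ≤ 2 * Nat.card G.edgeSet + G.girth * Nat.card V := by linarith

section FreedomNumber

open SimpleGraph Set

variable {V : Type*} {G : SimpleGraph V}

lemma freedomNumber_coe (S : G.Subgraph) :
    S.coe.freedomNumber = 2 * (S.verts.ncard : ℤ) - (S.edgeSet.ncard : ℤ) - 3 := by
  rw [freedomNumber, natCard_edgeSet_coe, Nat.card_coe_set_eq]

lemma freedomNumber_coe_top : (⊤ : G.Subgraph).coe.freedomNumber = G.freedomNumber := by
  rw [freedomNumber_coe, freedomNumber, Subgraph.verts_top, Subgraph.edgeSet_top, ncard_univ,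
    Nat.card_coe_set_eq]

lemma freedomNumber_coe_coeSubgraph {S : G.Subgraph} (T : S.coe.Subgraph) :
    (Subgraph.coeSubgraph T).coe.freedomNumber = T.coe.freedomNumber := by
  rw [freedomNumber_coe, freedomNumber_coe, Subgraph.verts_coeSubgraph, Subgraph.coeSubgraph,
    Subgraph.edgeSet_map, ncard_image_of_injective _ Subtype.val_injective,
    ncard_image_of_injective _ (Sym2.map.injective S.hom_injective)]

lemma freedomNumber_completeGraph [Finite V] :
    (⊤ : SimpleGraph V).freedomNumber = 2 * Nat.card V - (Nat.card V).choose 2 - 3 := by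
  classical
  have := Fintype.ofFinite V
  rw [freedomNumber, Nat.card_eq_fintype_card, Nat.card_eq_fintype_card, ← edgeFinset_card,
    card_edgeFinset_top_eq_card_choose_two]

lemma freedomNumber_coe_sup_add_freedomNumber_coe_inf [Finite V] (S T : G.Subgraph) :
    (S ⊔ T).coe.freedomNumber + (S ⊓ T).coe.freedomNumber =
      S.coe.freedomNumber + T.coe.freedomNumber := by
  have verts_eq := ncard_union_add_ncard_inter S.verts T.verts
  have edges_eq := ncard_union_add_ncard_inter S.edgeSet T.edgeSet
  rw [← Subgraph.verts_sup, ← Subgraph.verts_inf] at verts_eq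
  rw [← Subgraph.edgeSet_sup, ← Subgraph.edgeSet_inf] at edges_eq
  simp only [freedomNumber_coe]
  lia

end FreedomNumber

section Connectivity

open SimpleGraph

variable {V : Type*} {G : SimpleGraph V}

lemma SimpleGraph.IsSeparatedBy.exists_sup_eq_top {U : Finset V} (hU : G.IsSeparatedBy U) :
    ∃ S T : G.Subgraph, S ⊔ T = ⊤ ∧ (S ⊓ T).verts = U ∧
      S.verts ≠ Set.univ ∧ T.verts ≠ Set.univ := by
  obtain ⟨a, b, ha, hb, separated⟩ := hU
  let A : Set V := {x | ∃ w : G.Walk a x, ∀ y ∈ w.support, y ∉ U}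
  have a_mem : a ∈ A := ⟨Walk.nil, by simpa using ha⟩
  have b_notMem : b ∉ A := fun ⟨w, avoids⟩ =>
    let ⟨x, hx, hxU⟩ := separated w
    avoids x hx hxU
  have notMem_U {x : V} (hx : x ∈ A) : x ∉ U := hx.elim fun w avoids => avoids x w.end_mem_support
  have adj_mem {x y : V} (hx : x ∈ A) (hxy : G.Adj x y) (hy : y ∉ U) : y ∈ A := by
    obtain ⟨w, avoids⟩ := hx
    refine ⟨w.concat hxy, fun z hz => ?_⟩
    rw [Walk.support_concat, List.mem_append, List.mem_singleton] at hz
    rcases hz with hz | rfl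
    · exact avoids z hz
    · exact hy
  refine ⟨(⊤ : G.Subgraph).induce (A ∪ U), (⊤ : G.Subgraph).induce Aᶜ, ?_, ?_,
    (Set.ne_univ_iff_exists_notMem _).2 ⟨b, fun h => h.elim b_notMem hb⟩,
    (Set.ne_univ_iff_exists_notMem _).2 ⟨a, fun h => h a_mem⟩⟩
  · ext x y
    · simp only [Subgraph.verts_sup, Subgraph.induce_verts, Subgraph.verts_top]
      grind
    · simp only [Subgraph.sup_adj, Subgraph.induce_adj, Subgraph.top_adj]
      grind [G.adj_symm]
  · rw [Subgraph.verts_inf, Subgraph.induce_verts, Subgraph.induce_verts]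
    grind

lemma isProper_of_sup_eq_top [Finite V] {S T : G.Subgraph} (sup_eq : S ⊔ T = ⊤)
    (hS : S.verts ≠ Set.univ) (hT : T.verts ≠ Set.univ) (two_le : 2 ≤ (S ⊓ T).verts.ncard) :
    S.IsProper := by
  refine ⟨fun h => hS (congrArg Subgraph.verts h), ?_⟩
  have verts_eq : S.verts ∪ T.verts = Set.univ := congrArg Subgraph.verts sup_eq
  have inf_ssubset : (S ⊓ T).verts ⊂ S.verts :=
    inf_lt_left.2 fun subset => hT (Set.union_eq_right.2 subset ▸ verts_eq)
  rw [Nat.card_coe_set_eq]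
  exact two_le.trans_lt (Set.ncard_lt_ncard inf_ssubset)

lemma SimpleGraph.IsMConnected.connected [Finite V] {m : ℕ} (hG : G.IsMConnected m)
    (hm : 1 ≤ m) : G.Connected := by
  classical
  have : Nonempty V := (Nat.card_pos_iff.1 (by have := hG.1; lia)).1
  refine ⟨fun a b => ?_⟩
  by_contra not_reachable
  have := Fintype.ofFinite V
  have le_card : m - 1 ≤ ({a, b}ᶜ : Finset V).card := by
    have m_lt := hG.1
    have pair_le := Finset.card_le_two (a := a) (b := b)
    rw [Nat.card_eq_fintype_card] at m_lt
    rw [Finset.card_compl]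
    lia
  obtain ⟨U, hU, card_eq⟩ := Finset.exists_subset_card_eq le_card
  refine hG.2 U (by lia) ⟨a, b, fun ha => ?_, fun hb => ?_, fun w => absurd ⟨w⟩ not_reachable⟩
  · simpa using hU ha
  · simpa using hU hb

end Connectivity

section Laman

open SimpleGraph

variable {V : Type*} {G : SimpleGraph V}

lemma SimpleGraph.IsLaman.coe_of_freedomNumber_eq_zero (hG : G.IsLaman) {S : G.Subgraph}
    (hS : S.IsProper) (eq_zero : S.coe.freedomNumber = 0) : S.coe.IsLaman := by
  refine ⟨⟨eq_zero.ge, fun T hT => ?_⟩, eq_zero⟩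
  rw [← freedomNumber_coe_coeSubgraph]
  refine hG.1.2 _ ⟨ne_top_of_le_ne_top hS.1 (Subgraph.coeSubgraph_le T), ?_⟩
  rw [Subgraph.verts_coeSubgraph, Nat.card_image_of_injective Subtype.val_injective]
  exact hT.2

lemma SimpleGraph.IsLaman.natCard_edgeSet_add_three (hG : G.IsLaman) :
    Nat.card G.edgeSet + 3 = 2 * Nat.card V := by
  have := hG.2
  rw [freedomNumber] at this
  lia

lemma SimpleGraph.IsLaman.not_isAcyclic [Finite V] (hG : G.IsLaman) (hV : 3 ≤ Nat.card V)
    (connected : G.Connected) : ¬ G.IsAcyclic := fun acyclic => by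
  have card_tree := (isTree_iff_connected_and_card.1 ⟨connected, acyclic⟩).2
  have card_laman := hG.natCard_edgeSet_add_three
  lia

lemma SimpleGraph.IsBasicLaman.one_le_freedomNumber (hG : G.IsBasicLaman) {S : G.Subgraph}
    (hS : S.IsProper) : 1 ≤ S.coe.freedomNumber :=
  (hG.1.1.2 S hS).lt_of_ne' fun eq_zero => hG.2 S hS (hG.1.coe_of_freedomNumber_eq_zero hS eq_zero)

theorem SimpleGraph.IsBasicLaman.isMConnected_three [Finite V] (hG : G.IsBasicLaman)
    (hV : 3 < Nat.card V) : G.IsMConnected 3 := by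
  refine ⟨hV, fun U card_eq separated => ?_⟩
  obtain ⟨S, T, sup_eq, inf_verts, hS, hT⟩ := separated.exists_sup_eq_top
  have ncard_inf : (S ⊓ T).verts.ncard = 2 := by
    rw [inf_verts, Set.ncard_coe_finset]
    lia
  have one_le_S := hG.one_le_freedomNumber (isProper_of_sup_eq_top sup_eq hS hT ncard_inf.ge)
  have one_le_T := hG.one_le_freedomNumber
    (isProper_of_sup_eq_top (sup_comm S T ▸ sup_eq) hT hS (inf_comm S T ▸ ncard_inf.ge))
  have modular := freedomNumber_coe_sup_add_freedomNumber_coe_inf S T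
  rw [sup_eq, freedomNumber_coe_top, hG.1.2, freedomNumber_coe, ncard_inf] at modular
  lia

theorem SimpleGraph.IsBasicLaman.cliqueFree_three [Finite V] (hG : G.IsBasicLaman)
    (hV : 3 < Nat.card V) : G.CliqueFree 3 := by
  intro s hs
  have ncard_eq : (s : Set V).ncard = 3 := (Set.ncard_coe_finset s).trans hs.card_eq
  have isProper : ((⊤ : G.Subgraph).induce s).IsProper := by
    refine ⟨fun h => ?_, ncard_eq.ge⟩
    have verts_eq : (s : Set V) = Set.univ := congrArg Subgraph.verts h
    rw [verts_eq, Set.ncard_univ] at ncard_eq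
    lia
  have coe_eq_top : ((⊤ : G.Subgraph).induce s).coe = ⊤ :=
    (induce_eq_coe_induce_top _).symm.trans (induce_eq_top.2 hs.isClique)
  have one_le := hG.one_le_freedomNumber isProper
  rw [coe_eq_top, freedomNumber_completeGraph, Nat.card_coe_set_eq, Subgraph.induce_verts,
    ncard_eq] at one_le
  norm_num [Nat.choose] at one_le

end Laman

theorem mainTheorem2 {V : Type*} [Finite V] (G : SimpleGraph V) (hG : G.IsBasicLaman)
    (hV : 3 < Nat.card V) : G.IsMConnected 3 ∧ ¬ G.IsPlanar := by
  have connected_three := hG.isMConnected_three hV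
  have connected := connected_three.connected (by lia)
  refine ⟨connected_three, fun planar => ?_⟩
  have girth := four_le_girth_of_cliqueFree_three (hG.cliqueFree_three hV)
    (hG.1.not_isAcyclic hV.le connected)
  have euler := planar.girth_mul_le connected
  have laman := hG.1.natCard_edgeSet_add_three
  nlinarith
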